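/- For a Boolean function $f:\{-1,1\}^{k}\to\{-1,1\}$ and $\omega\in\{-1,1\}^k$, let $\mathscr{P}_f(\omega)$ be the pivotal set, i.e. the set of coordinates $i\in\{1,\dots,k\}$ with $f(\omega)\neq f(\omega^i)$, where $\omega^i$ is $\omega$ with its $i$-th coordinate flipped. Let $(X(t))_{t\ge 0}$ be the continuous-time random walk on the hypercube $\{-1,1\}^k$ with rate $1$ clocks on the edges (the Markov jump process that crosses each edge at its current vertex at rate $1$), with $X(0)$ uniformly distributed. Let $f_n:\{-1,1\}^{k_n}\to\{-1,1\}$ be a sequence of Boolean functions, let $\mathscr{P}_n=\mathscr{P}_{f_n}(\omega)$ for $\omega$ uniform on $\{-1,1\}^{k_n}$, let $X_n$ be the above walk on $\{-1,1\}^{k_n}$, and let $C_n$ be the number of times that $f_n(X_n(t))$ changes value in the time interval $[0,1]$. Suppose that there is a sequence of positive integers $a_n\to\infty$ such that $\mathbb{P}[|\mathscr{P}_n|>a_n]\to 1$ as $n\to\infty$. Then the sequence $f_n$ is volatile, i.e. $C_n\to\infty$ in distribution: $\mathbb{P}[C_n\le m]\to 0$ for every $m\in\mathbb{N}$. In particular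 $\mathbb{P}[C_n=0]\to 0$. -/

import Mathlib

open Filter Topology MeasureTheory ProbabilityTheory
open scoped ENNReal

/-- The hypercube `{-1,1}^k`; the two-element set `{-1,1}` is the type `ℤˣ` of units of `ℤ`. -/
abbrev Cube (k : ℕ) : Type := Fin k → ℤˣ

/-- Every subset of `{-1,1}` is measurable. -/
instance intUnits_discreteMeasurableSpace : DiscreteMeasurableSpace ℤˣ where
  forall_measurableSet s :=
    ⟨Units.val '' s, MeasurableSet.of_discrete, Set.preimage_image_eq s Units.val_injective⟩

/-- The vertex `ω^i`: `ω` with its `i`-th coordinate flipped. -/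
def Cube.flip {k : ℕ} (ω : Cube k) (i : Fin k) : Cube k := Function.update ω i (-ω i)

/-- The pivotal set of the Boolean function `f` at `ω`: all `i` with `f ω ≠ f (ω^i)`. -/
def pivotalSet {k : ℕ} (f : Cube k → ℤˣ) (ω : Cube k) : Finset (Fin k) :=
  Finset.univ.filter fun i => f ω ≠ f (ω.flip i)

/-- The uniform probability measure on the hypercube (the stationary law of the walk). -/
noncomputable def uniformCube (k : ℕ) : Measure (Cube k) :=
  (PMF.uniformOfFintype (Cube k)).toMeasure

instance uniformCube_isProbabilityMeasure (k : ℕ) : IsProbabilityMeasure (uniformCube k) := by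
  unfold uniformCube; infer_instance

instance expMeasure_one_isProbabilityMeasure : IsProbabilityMeasure (expMeasure 1) :=
  isProbabilityMeasure_expMeasure one_pos

/-! The continuous-time random walk on the hypercube with rate `1` clocks on the edges, that is, the
Markov jump process that crosses each edge at its current vertex at rate `1`, in its standard
construction: whenever the walk arrives at a vertex, the `k` edges at this vertex are given
fresh independent `Exp(1)` clocks, and the walk crosses the edge whose clock rings first, at the time
when it rings (by the lack of memory of the exponential law, restarting the clocks at each
jump does not matter). -/

/-- Sample space of the walk: the starting vertex `x`, and for every `j : ℕ` and every direction `i`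
the waiting time `ξ j i` of the clock on the edge in direction `i` after the `j`-th jump. -/
abbrev WalkSpace (k : ℕ) : Type := Cube k × (ℕ → Fin k → ℝ)

/-- The starting vertex is uniform, all waiting times are `Exp(1)`, and everything is independent. -/
noncomputable def walkMeasure (k : ℕ) : Measure (WalkSpace k) :=
  (uniformCube k).prod
    (Measure.infinitePi fun _ : ℕ => Measure.pi fun _ : Fin k => expMeasure 1)

instance walkMeasure_isProbabilityMeasure (k : ℕ) : IsProbabilityMeasure (walkMeasure k) := by
  unfold walkMeasure; infer_instance

/-- The time of jump number `j + 1`: the sum of the first `j + 1` holding times, where a holding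
time is the minimum of the waiting times (it is `∞` if there is no edge, that is, if `k = 0`). -/
noncomputable def jumpTime {k : ℕ} (w : WalkSpace k) (j : ℕ) : ℝ≥0∞ :=
  ∑ l ∈ Finset.range (j + 1), ⨅ i : Fin k, ENNReal.ofReal (w.2 l i)

open Classical in
/-- The vertex reached after `j` jumps: each jump flips the coordinate with the smallest waiting time
(almost surely this coordinate is unique). -/
noncomputable def jumpChain {k : ℕ} (w : WalkSpace k) : ℕ → Cube k
  | 0 => w.1
  | j + 1 => fun i =>
      if ∀ i', w.2 j i ≤ w.2 j i' then -(jumpChain w j i) else jumpChain w j i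

/-- The position `X(t)` of the walk at time `t ≥ 0`; the number of jumps up to time `t` is
almost surely finite. -/
noncomputable def walk {k : ℕ} (w : WalkSpace k) (t : ℝ) : Cube k :=
  jumpChain w {j : ℕ | jumpTime w j ≤ ENNReal.ofReal t}.ncard

/-- The number `C` of times `f (X(t))` changes value in `[0,1]`: the number of `t ∈ (0,1]` such that
`f (X(s))` is not equal to `f (X(t))` for all `s < t` close to `t`. -/
noncomputable def changeCount {k : ℕ} (f : Cube k → ℤˣ) (w : WalkSpace k) : ℕ∞ :=
  {t : ℝ | t ∈ Set.Ioc (0 : ℝ) 1 ∧ ¬ ∀ᶠ s in 𝓝[<] t, f (walk w s) = f (walk w t)}.encard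

/-- Volatility: `C_n → ∞` in distribution, that is, `P[C_n ≤ m] → 0` for every `m`. -/
def Volatile (k : ℕ → ℕ) (f : ∀ n, Cube (k n) → ℤˣ) : Prop :=
  ∀ m : ℕ, Tendsto (fun n => walkMeasure (k n) {w | changeCount (f n) w ≤ (m : ℕ∞)}) atTop (𝓝 0)

/-! Fix a large `q` and follow only the first `M = ⌊k / q⌋` jumps. A holding time has mean at most
`1 / k`, so by Markov's inequality these jumps are over by time `1` except with probability `M / k ≤
1 / q`.

What remains concerns the discrete walk, whose start and first `M` directions are uniform, so it is
a count of pairs `(x, s)` (`card_pathChanges_le`). Let `G` be the set of vertices with more than `a`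
pivotal coordinates. If a path has at most `m` changes, one of two rare things happens. (1) At least
half of its visits are outside `G`. By stationarity and Markov this has probability at most `2 *
P(Gᶜ)`. (2) At least `M / 2` visits are in `G`. From a vertex of `G` a step changes `f` with
probability above `a / k`, so `2 ^ (-changes) * exp (a / (2k) * visits to G)` has mean at most `1`
(`sum_path_weight_le`). This case thus has probability at most `2 ^ m * exp (-a M / (4k))`, which
tends to `0` since `M / k` is of order `1 / q` and `a → ∞`. Let `n → ∞`, then `q → ∞`. -/

/-! ### Independent exponential clocks at one vertex -/

lemma expMeasure_one_Ioi {t : ℝ} (ht : 0 ≤ t) :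
    expMeasure 1 (Set.Ioi t) = ENNReal.ofReal (Real.exp (-t)) := by
  have h := cdf_expMeasure_eq one_pos t
  rw [if_pos ht, cdf_eq_real, one_mul] at h
  have h2 : (expMeasure 1).real (Set.Ioi t) = Real.exp (-t) := by
    rw [← Set.compl_Iic, measureReal_compl measurableSet_Iic, h]; simp
  rw [← h2, ofReal_measureReal]

instance expMeasure_one_nullSingletonClass : NullSingletonClass (expMeasure 1) := by
  refine ⟨fun x => ?_⟩
  unfold expMeasure gammaMeasure
  exact withDensity_absolutelyContinuous _ _ (measure_singleton x)

lemma expMeasure_one_ae_pos : ∀ᵐ x ∂expMeasure 1, 0 < x := by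
  have h : expMeasure 1 (Set.Ioi 0) = 1 := by simp [expMeasure_one_Ioi le_rfl]
  exact (mem_ae_iff_prob_eq_one measurableSet_Ioi).2 h

/-- The law of the clocks at one vertex. -/
noncomputable abbrev clockMeasure (k : ℕ) : Measure (Fin k → ℝ) :=
  Measure.pi fun _ : Fin k => expMeasure 1

lemma clockMeasure_ae_pos (k : ℕ) : ∀ᵐ ξ ∂clockMeasure k, ∀ i, 0 < ξ i :=
  ae_all_iff.2 fun i =>
    (measurePreserving_eval (fun _ : Fin k => expMeasure 1) i).quasiMeasurePreserving.ae
      expMeasure_one_ae_pos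

lemma prod_diagonal_null (μ : Measure ℝ) [SFinite μ] [NullSingletonClass μ] :
    (μ.prod μ) {p | p.1 = p.2} = 0 := by
  rw [Measure.measure_prod_null (measurableSet_eq_fun measurable_fst measurable_snd)]
  refine Eventually.of_forall fun x => ?_
  have : Prod.mk x ⁻¹' {p : ℝ × ℝ | p.1 = p.2} = {x} := by ext y; simp [eq_comm]
  simp [this]

lemma clockMeasure_ae_injective (k : ℕ) : ∀ᵐ ξ ∂clockMeasure k, Function.Injective ξ := by
  have h : ∀ i j : Fin k, i ≠ j → ∀ᵐ ξ ∂clockMeasure k, ξ i ≠ ξ j := by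
    intro i j hij
    have hind : iIndepFun (fun (i : Fin k) (ξ : Fin k → ℝ) => ξ i) (clockMeasure k) :=
      iIndepFun_pi (X := fun _ x => x) fun _ => aemeasurable_id
    have hp := (indepFun_iff_map_prod_eq_prod_map_map (measurable_pi_apply i).aemeasurable
      (measurable_pi_apply j).aemeasurable).1
      (hind.indepFun hij)
    have he : ∀ i : Fin k, (clockMeasure k).map (fun ξ => ξ i) = expMeasure 1 := fun i =>
      (measurePreserving_eval (fun _ : Fin k => expMeasure 1) i).map_eq
    rw [he, he] at hp
    have h0 := prod_diagonal_null (expMeasure 1)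
    rw [← hp, Measure.map_apply (by fun_prop)
      (measurableSet_eq_fun measurable_fst measurable_snd)] at h0
    rw [ae_iff]
    simpa using h0
  have h' : ∀ᵐ ξ ∂clockMeasure k, ∀ i j : Fin k, i ≠ j → ξ i ≠ ξ j :=
    ae_all_iff.2 fun i => ae_all_iff.2 fun j => by
      by_cases hij : i = j
      · simp [hij]
      · filter_upwards [h i j hij] with ξ hξ _ using hξ
  filter_upwards [h'] with ξ hξ i j hij
  by_contra hne
  exact hξ i j hne hij

/-- The event that the clock in direction `i` rings strictly before all the others. -/
def ringsFirst {k : ℕ} (i : Fin k) : Set (Fin k → ℝ) := {ξ | ∀ j, j ≠ i → ξ i < ξ j}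

lemma measurableSet_ringsFirst {k : ℕ} (i : Fin k) : MeasurableSet (ringsFirst i) := by
  have : ringsFirst i = ⋂ j : Fin k, ⋂ _ : j ≠ i, {ξ : Fin k → ℝ | ξ i < ξ j} := by
    ext ξ; simp [ringsFirst]
  rw [this]
  exact MeasurableSet.iInter fun j => MeasurableSet.iInter fun _ =>
    measurableSet_lt (measurable_pi_apply i) (measurable_pi_apply j)

lemma exists_mem_ringsFirst {k : ℕ} (hk : 0 < k) {ξ : Fin k → ℝ} (h : Function.Injective ξ) :
    ∃ i, ξ ∈ ringsFirst i := by
  have : Nonempty (Fin k) := ⟨⟨0, hk⟩⟩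
  obtain ⟨i, hi⟩ := Finite.exists_min ξ
  exact ⟨i, fun j hj => lt_of_le_of_ne (hi j) fun e => hj (h e).symm⟩

lemma clockMeasure_ringsFirst_eq {k : ℕ} (i j : Fin k) :
    clockMeasure k (ringsFirst i) = clockMeasure k (ringsFirst j) := by
  have h := measurePreserving_piCongrLeft (fun _ : Fin k => expMeasure 1) (Equiv.swap i j)
  have h2 := h.measure_preimage (measurableSet_ringsFirst i).nullMeasurableSet
  rw [← h2]
  congr 1
  ext ξ
  have hc : ∀ a, MeasurableEquiv.piCongrLeft (fun _ : Fin k => ℝ) (Equiv.swap i j) ξ a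
      = ξ (Equiv.swap i j a) := by
    intro a
    have := Equiv.piCongrLeft_apply_apply (fun _ : Fin k => ℝ) (Equiv.swap i j) ξ
      (Equiv.swap i j a)
    rwa [Equiv.swap_apply_self] at this
  simp only [ringsFirst, Set.mem_preimage, Set.mem_ofPred_eq, hc, Equiv.swap_apply_left]
  constructor
  · intro H a ha
    simpa using H (Equiv.swap i j a) fun e => ha (by simpa using congrArg (Equiv.swap i j) e)
  · intro H a ha
    exact H (Equiv.swap i j a) fun e => ha (by simpa using congrArg (Equiv.swap i j) e)

/-- The `k` events are disjoint and, by exchangeability, equally likely. An upper bound suffices, as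
it only feeds a union bound over paths. -/
lemma clockMeasure_ringsFirst_le {k : ℕ} (i : Fin k) :
    clockMeasure k (ringsFirst i) ≤ (k : ℝ≥0∞)⁻¹ := by
  have hd : Pairwise (Function.onFun Disjoint (ringsFirst (k := k))) := by
    intro a b hab
    refine Set.disjoint_left.2 fun ξ ha hb => ?_
    exact lt_asymm (ha b hab.symm) (hb a hab)
  have h := tsum_meas_le_meas_iUnion_of_disjoint (clockMeasure k)
    (fun a => measurableSet_ringsFirst a) hd
  have h1 := h.trans prob_le_one
  rw [tsum_fintype, Finset.sum_congr rfl fun a _ => clockMeasure_ringsFirst_eq a i] at h1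
  simp only [Finset.sum_const, Finset.card_univ, Fintype.card_fin, nsmul_eq_mul] at h1
  rw [ENNReal.le_inv_iff_mul_le, mul_comm]
  exact h1

lemma clockMeasure_forall_lt {k : ℕ} {t : ℝ} (ht : 0 ≤ t) :
    clockMeasure k (Set.univ.pi fun _ => Set.Ioi t) = ENNReal.ofReal (Real.exp (-(k * t))) := by
  rw [Measure.pi_pi]
  simp only [expMeasure_one_Ioi ht, Finset.prod_const, Finset.card_univ, Fintype.card_fin]
  rw [← ENNReal.ofReal_pow (Real.exp_nonneg _), ← Real.exp_nat_mul]
  congr 2; ring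

lemma lintegral_holding_le {k : ℕ} (hk : 0 < k) :
    ∫⁻ ξ, ⨅ i, ENNReal.ofReal (ξ i) ∂clockMeasure k ≤ (k : ℝ≥0∞)⁻¹ := by
  have : Nonempty (Fin k) := ⟨⟨0, hk⟩⟩
  have hk' : (0 : ℝ) < k := by exact_mod_cast hk
  have hm : Measurable fun ξ : Fin k → ℝ => ⨅ i, ξ i := Measurable.iInf fun i => measurable_pi_apply i
  have e1 : ∀ ξ : Fin k → ℝ, ⨅ i, ENNReal.ofReal (ξ i) = ENNReal.ofReal (⨅ i, ξ i) := by
    intro ξ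
    refine le_antisymm ?_ (le_iInf fun i =>
      ENNReal.ofReal_le_ofReal (ciInf_le (Set.finite_range ξ).bddBelow i))
    obtain ⟨i, hi⟩ := exists_eq_ciInf_of_finite (f := ξ)
    rw [← hi]; exact iInf_le _ i
  simp_rw [e1]
  rw [lintegral_eq_lintegral_meas_lt _ _ hm.aemeasurable]
  -- The tail `exp (-k t)` of the minimum is `1 / k` times the `Exp(k)` density, whose integral is
  -- `1`.
  · have e2 : ∀ t ∈ Set.Ioi (0 : ℝ), clockMeasure k {ξ | t < ⨅ i, ξ i}
        ≤ (k : ℝ≥0∞)⁻¹ * exponentialPDF k t := by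
      intro t ht
      rw [exponentialPDF_of_nonneg (le_of_lt ht), ENNReal.ofReal_mul hk'.le, ENNReal.ofReal_natCast,
        ← mul_assoc, ENNReal.inv_mul_cancel (by positivity) (by simp), one_mul,
        ← clockMeasure_forall_lt (le_of_lt ht)]
      refine measure_mono fun ξ hξ i _ => ?_
      exact lt_of_lt_of_le hξ (ciInf_le (Set.finite_range ξ).bddBelow i)
    calc _ ≤ ∫⁻ t in Set.Ioi (0 : ℝ), (k : ℝ≥0∞)⁻¹ * exponentialPDF k t :=
          setLIntegral_mono' measurableSet_Ioi e2
      _ ≤ ∫⁻ t, (k : ℝ≥0∞)⁻¹ * exponentialPDF k t := setLIntegral_le_lintegral _ _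
      _ = (k : ℝ≥0∞)⁻¹ := by
          rw [lintegral_const_mul' _ _ (by simp [hk.ne']), lintegral_exponentialPDF_eq_one hk', mul_one]
  · filter_upwards [clockMeasure_ae_pos k] with ξ hξ
    exact le_ciInf fun i => (hξ i).le

/-! ### The first `M` directions and holding times -/

/-- The law of all clocks. -/
noncomputable abbrev clocksMeasure (k : ℕ) : Measure (ℕ → Fin k → ℝ) :=
  Measure.infinitePi fun _ : ℕ => clockMeasure k

lemma walkMeasure_ae_snd {k : ℕ} {p : (ℕ → Fin k → ℝ) → Prop} (h : ∀ᵐ ξ ∂clocksMeasure k, p ξ) :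
    ∀ᵐ w ∂walkMeasure k, p w.2 :=
  (Measure.quasiMeasurePreserving_snd (μ := uniformCube k) (ν := clocksMeasure k)).ae h

lemma clocksMeasure_ae_forall {k : ℕ} {p : (Fin k → ℝ) → Prop} (h : ∀ᵐ ξ ∂clockMeasure k, p ξ) :
    ∀ᵐ ξ ∂clocksMeasure k, ∀ l, p (ξ l) :=
  ae_all_iff.2 fun l =>
    (measurePreserving_eval_infinitePi (fun _ : ℕ => clockMeasure k) l).quasiMeasurePreserving.ae h

lemma walkMeasure_directions_le {k : ℕ} (M : ℕ) (x : Cube k) (s : Fin M → Fin k) :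
    walkMeasure k {w | w.1 = x ∧ ∀ l : Fin M, w.2 l ∈ ringsFirst (s l)}
      ≤ (Fintype.card (Cube k) : ℝ≥0∞)⁻¹ * ((k : ℝ≥0∞)⁻¹) ^ M := by
  rcases Nat.eq_zero_or_pos M with rfl | hM
  · have : {w : WalkSpace k | w.1 = x ∧ ∀ l : Fin 0, w.2 l ∈ ringsFirst (s l)}
        = {x} ×ˢ Set.univ := by ext w; simp
    rw [this, walkMeasure, Measure.prod_prod]
    simp [uniformCube]
  -- The remainder mod `M` only extends `s` to all of `ℕ`; indices `l ≥ M` play no role.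
  let t : ℕ → Set (Fin k → ℝ) := fun l => ringsFirst (s ⟨l % M, Nat.mod_lt _ hM⟩)
  have e : {w : WalkSpace k | w.1 = x ∧ ∀ l : Fin M, w.2 l ∈ ringsFirst (s l)}
      = {x} ×ˢ Set.pi (Finset.range M) t := by
    ext w
    simp only [Set.mem_ofPred_eq, Set.mem_prod, Set.mem_singleton_iff, Set.mem_pi,
      Finset.coe_range, Set.mem_Iio, t]
    refine and_congr_right fun _ => ⟨fun h l hl => ?_, fun h l => ?_⟩
    · simpa [Nat.mod_eq_of_lt hl] using h ⟨l, hl⟩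
    · simpa [Nat.mod_eq_of_lt l.2] using h l l.2
  rw [e, walkMeasure, Measure.prod_prod,
    Measure.infinitePi_pi _ fun l _ => measurableSet_ringsFirst _]
  gcongr
  · simp [uniformCube]
  · calc _ ≤ ∏ _l ∈ Finset.range M, (k : ℝ≥0∞)⁻¹ :=
          Finset.prod_le_prod' fun l _ => clockMeasure_ringsFirst_le _
      _ = _ := by simp

lemma walkMeasure_sum_holding_gt_one_le {k : ℕ} (hk : 0 < k) (M : ℕ) :
    walkMeasure k {w | 1 < ∑ l ∈ Finset.range M, ⨅ i, ENNReal.ofReal (w.2 l i)}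
      ≤ M * (k : ℝ≥0∞)⁻¹ := by
  have hm : Measurable fun ξ : Fin k → ℝ => ⨅ i, ENNReal.ofReal (ξ i) :=
    Measurable.iInf fun i => (measurable_pi_apply i).ennreal_ofReal
  have hmp : ∀ l, MeasurePreserving (fun w : WalkSpace k => w.2 l) (walkMeasure k)
      (clockMeasure k) := fun l =>
    (measurePreserving_eval_infinitePi (fun _ : ℕ => clockMeasure k) l).comp
      measurePreserving_snd
  have hml : ∀ l, Measurable fun w : WalkSpace k => ⨅ i, ENNReal.ofReal (w.2 l i) := fun l =>
    hm.comp (hmp l).measurable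
  calc walkMeasure k {w | 1 < ∑ l ∈ Finset.range M, ⨅ i, ENNReal.ofReal (w.2 l i)}
      ≤ walkMeasure k {w | 1 ≤ ∑ l ∈ Finset.range M, ⨅ i, ENNReal.ofReal (w.2 l i)} :=
        measure_mono (Set.ofPred_subset_ofPred.2 fun w hw => hw.le)
    _ ≤ ∫⁻ w, ∑ l ∈ Finset.range M, ⨅ i, ENNReal.ofReal (w.2 l i) ∂walkMeasure k := by
        simpa using mul_meas_ge_le_lintegral (μ := walkMeasure k)
          (Finset.measurable_sum (Finset.range M) fun l _ => hml l) 1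
    _ = ∑ l ∈ Finset.range M, ∫⁻ ξ, ⨅ i, ENNReal.ofReal (ξ i) ∂clockMeasure k := by
        rw [lintegral_finsetSum _ fun l _ => hml l]
        exact Finset.sum_congr rfl fun l _ => (hmp l).lintegral_comp hm
    _ ≤ ∑ _l ∈ Finset.range M, (k : ℝ≥0∞)⁻¹ :=
        Finset.sum_le_sum fun _ _ => lintegral_holding_le hk
    _ = M * (k : ℝ≥0∞)⁻¹ := by simp

/-! ### Counting paths with few changes -/

lemma Cube.flip_flip {k : ℕ} (x : Cube k) (i : Fin k) : (x.flip i).flip i = x := by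
  simp [Cube.flip]

/-- The number of value changes of `f` along the path that starts at `x` and follows the
directions `s`. -/
def pathChanges {k : ℕ} (f : Cube k → ℤˣ) : (M : ℕ) → Cube k → (Fin M → Fin k) → ℕ
  | 0, _, _ => 0
  | M + 1, x, s =>
      (if f x ≠ f (x.flip (s 0)) then 1 else 0) + pathChanges f M (x.flip (s 0)) (Fin.tail s)

/-- The number of visits to `B`, the final vertex excluded, of the path that starts at `x` and
follows the directions `s`. -/
def pathVisits {k : ℕ} (B : Finset (Cube k)) : (M : ℕ) → Cube k → (Fin M → Fin k) → ℕ
  | 0, _, _ => 0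
  | M + 1, x, s => (if x ∈ B then 1 else 0) + pathVisits B M (x.flip (s 0)) (Fin.tail s)

lemma pathVisits_add_compl {k : ℕ} (B : Finset (Cube k)) (M : ℕ) (x : Cube k)
    (s : Fin M → Fin k) : pathVisits B M x s + pathVisits Bᶜ M x s = M := by
  induction M generalizing x with
  | zero => rfl
  | succ M ih =>
    have := ih (x.flip (s 0)) (Fin.tail s)
    simp only [pathVisits, Finset.mem_compl]
    split_ifs <;> omega

lemma sum_fin_succ_arrow {R : Type*} [AddCommMonoid R] {k M : ℕ} (F : (Fin (M + 1) → Fin k) → R) :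
    ∑ s, F s = ∑ i, ∑ s : Fin M → Fin k, F (Fin.cons i s) := by
  rw [← (Fin.consEquiv fun _ : Fin (M + 1) => Fin k).sum_comp, Fintype.sum_prod_type]
  rfl

lemma sum_flip {R : Type*} [AddCommMonoid R] {k : ℕ} (i : Fin k) (F : Cube k → R) :
    ∑ x : Cube k, F (x.flip i) = ∑ x, F x :=
  Equiv.sum_comp (Function.Involutive.toPerm (fun x : Cube k => x.flip i)
    fun x => x.flip_flip i) F

/-- Stationarity of the uniform law: each flip permutes the cube, so every one of the `M` times
contributes `B.card * k ^ M`. -/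
lemma sum_pathVisits {k : ℕ} (B : Finset (Cube k)) (M : ℕ) :
    ∑ x, ∑ s, pathVisits B M x s = M * B.card * k ^ M := by
  induction M with
  | zero => simp [pathVisits]
  | succ M ih =>
    have h : ∀ x, ∑ s, pathVisits B (M + 1) x s
        = (if x ∈ B then 1 else 0) * k ^ (M + 1)
          + ∑ i, ∑ s, pathVisits B M (x.flip i) s := by
      intro x
      rw [sum_fin_succ_arrow]
      simp only [pathVisits, Fin.cons_zero, Fin.tail_cons, Finset.sum_add_distrib]
      simp [pow_succ]
      split_ifs <;> ring
    simp_rw [h, Finset.sum_add_distrib]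
    rw [Finset.sum_comm]
    simp_rw [sum_flip _ fun x => ∑ s, pathVisits B M x s, ih]
    rw [← Finset.sum_mul]
    simp
    ring

/-- One step of the exponential supermartingale. -/
lemma sum_step_weight_le {k : ℕ} (f : Cube k → ℤˣ) (x : Cube k) {r : ℝ}
    (hr : r ≤ Real.exp ((pivotalSet f x).card / (2 * k))) :
    ∑ i : Fin k, (2⁻¹ : ℝ) ^ (if f x ≠ f (x.flip i) then 1 else 0) * r ≤ k := by
  rcases Nat.eq_zero_or_pos k with rfl | hk
  · simp
  have hk' : (0 : ℝ) < k := by exact_mod_cast hk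
  set p : ℝ := ((pivotalSet f x).card : ℝ) with hp
  have hpk : p ≤ k := by
    have := Finset.card_le_univ (pivotalSet f x)
    rw [Fintype.card_fin] at this
    rw [hp]
    exact_mod_cast this
  have h1 : ∑ i : Fin k, (2⁻¹ : ℝ) ^ (if f x ≠ f (x.flip i) then 1 else 0) = k - p / 2 := by
    have h2 : ∀ i : Fin k, (2⁻¹ : ℝ) ^ (if f x ≠ f (x.flip i) then 1 else 0)
        = 1 - (if f x ≠ f (x.flip i) then 1 else 0) / 2 := by
      intro i; split_ifs <;> norm_num
    simp_rw [h2]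
    rw [Finset.sum_sub_distrib, ← Finset.sum_div, Finset.sum_boole]
    simp [hp, pivotalSet]
  rw [← Finset.sum_mul, h1]
  -- The left side is the mean of `2 ^ (-change)` over a uniform direction, which `r` may thus
  -- compensate.
  have h3 : 1 - p / (2 * k) ≤ Real.exp (-(p / (2 * k))) := by
    have := Real.add_one_le_exp (-(p / (2 * k)))
    linarith
  calc (k - p / 2) * r ≤ (k - p / 2) * Real.exp (p / (2 * k)) := by
        apply mul_le_mul_of_nonneg_left hr; linarith
    _ = k * ((1 - p / (2 * k)) * Real.exp (p / (2 * k))) := by field_simp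
    _ ≤ k * (Real.exp (-(p / (2 * k))) * Real.exp (p / (2 * k))) := by gcongr
    _ = k := by rw [← Real.exp_add]; simp

/-- The vertices with more than `a` pivotal coordinates. -/
def manyPivotals {k : ℕ} (f : Cube k → ℤˣ) (a : ℕ) : Finset (Cube k) :=
  Finset.univ.filter fun x => a < (pivotalSet f x).card

lemma sum_path_weight_le {k : ℕ} (f : Cube k → ℤˣ) (a M : ℕ) (x : Cube k) :
    ∑ s, (2⁻¹ : ℝ) ^ pathChanges f M x s
      * Real.exp (a / (2 * k)) ^ pathVisits (manyPivotals f a) M x s ≤ (k : ℝ) ^ M := by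
  induction M generalizing x with
  | zero => simp [pathChanges, pathVisits]
  | succ M ih =>
    rw [sum_fin_succ_arrow]
    set r : ℝ := Real.exp (a / (2 * k)) ^ (if x ∈ manyPivotals f a then 1 else 0) with hrdef
    have hr0 : 0 ≤ r := by positivity
    have hr : r ≤ Real.exp ((pivotalSet f x).card / (2 * k)) := by
      rw [hrdef]
      split_ifs with h
      · rw [pow_one]
        have : a < (pivotalSet f x).card := by simpa [manyPivotals] using h
        gcongr
      · rw [pow_zero]
        exact Real.one_le_exp (by positivity)
    calc _ = ∑ i : Fin k, ((2⁻¹ : ℝ) ^ (if f x ≠ f (x.flip i) then 1 else 0) * r) *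
          ∑ s, (2⁻¹ : ℝ) ^ pathChanges f M (x.flip i) s
            * Real.exp (a / (2 * k)) ^ pathVisits (manyPivotals f a) M (x.flip i) s := by
          refine Finset.sum_congr rfl fun i _ => ?_
          rw [Finset.mul_sum]
          refine Finset.sum_congr rfl fun s _ => ?_
          simp only [pathChanges, pathVisits, Fin.cons_zero, Fin.tail_cons, pow_add, hrdef]
          ring
      _ ≤ ∑ i : Fin k, ((2⁻¹ : ℝ) ^ (if f x ≠ f (x.flip i) then 1 else 0) * r) * (k : ℝ) ^ M := by
          gcongr with i
          exact ih _
      _ ≤ k * (k : ℝ) ^ M := by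
          rw [← Finset.sum_mul]
          gcongr
          exact sum_step_weight_le f x hr
      _ = (k : ℝ) ^ (M + 1) := by ring

/-- Visits to `G` and to `Gᶜ` add up to `M`, so one of them is at least `M / 2`. The indicator is
bounded pointwise by a Markov term for `Gᶜ` plus a Chernoff term for `G`, and then summed. -/
lemma card_pathChanges_le {k : ℕ} (f : Cube k → ℤˣ) (a m : ℕ) {M : ℕ} (hM : 0 < M) :
    ((Finset.univ.filter fun q : Cube k × (Fin M → Fin k) =>
        pathChanges f M q.1 q.2 ≤ m).card : ℝ)
      ≤ 2 * (manyPivotals f a)ᶜ.card * (k : ℝ) ^ M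
        + 2 ^ m * Real.exp (-(a * M / (4 * k))) * (Fintype.card (Cube k) * (k : ℝ) ^ M) := by
  have hM' : (0 : ℝ) < M := by exact_mod_cast hM
  set G := manyPivotals f a
  set r : ℝ := Real.exp (a / (2 * k)) with hr
  have hpt : ∀ q : Cube k × (Fin M → Fin k),
      (if pathChanges f M q.1 q.2 ≤ m then (1 : ℝ) else 0)
        ≤ 2 / M * pathVisits Gᶜ M q.1 q.2 + 2 ^ m * Real.exp (-(a * M / (4 * k)))
          * ((2⁻¹ : ℝ) ^ pathChanges f M q.1 q.2 * r ^ pathVisits G M q.1 q.2) := by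
    intro q
    split_ifs with hq
    · by_cases hv : M ≤ 2 * pathVisits Gᶜ M q.1 q.2
      · have hv' : (M : ℝ) ≤ 2 * pathVisits Gᶜ M q.1 q.2 := by exact_mod_cast hv
        have h1 : 1 ≤ 2 / (M : ℝ) * pathVisits Gᶜ M q.1 q.2 := by
          rw [div_mul_eq_mul_div, one_le_div hM']; exact hv'
        have h2 : 0 ≤ 2 ^ m * Real.exp (-(a * M / (4 * k)))
          * ((2⁻¹ : ℝ) ^ pathChanges f M q.1 q.2 * r ^ pathVisits G M q.1 q.2) := by positivity
        linarith
      · have hG : M ≤ 2 * pathVisits G M q.1 q.2 := by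
          have := pathVisits_add_compl G M q.1 q.2
          omega
        have hG' : (M : ℝ) ≤ 2 * pathVisits G M q.1 q.2 := by exact_mod_cast hG
        have h1 : (2⁻¹ : ℝ) ^ m ≤ (2⁻¹ : ℝ) ^ pathChanges f M q.1 q.2 :=
          pow_le_pow_of_le_one (by norm_num) (by norm_num) hq
        have h2 : Real.exp (a * M / (4 * k)) ≤ r ^ pathVisits G M q.1 q.2 := by
          rw [hr, ← Real.exp_nat_mul, Real.exp_le_exp]
          calc (a * M / (4 * k) : ℝ) = M * (a / (4 * k)) := by ring
            _ ≤ (2 * pathVisits G M q.1 q.2) * (a / (4 * k)) := by gcongr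
            _ = _ := by ring
        have h3 : 1 = 2 ^ m * Real.exp (-(a * M / (4 * k)))
            * ((2⁻¹ : ℝ) ^ m * Real.exp (a * M / (4 * k))) := by
          rw [Real.exp_neg, inv_pow]
          field_simp
        have h4 : (0 : ℝ) ≤ 2 / M * pathVisits Gᶜ M q.1 q.2 := by positivity
        have h5 : 2 ^ m * Real.exp (-(a * M / (4 * k)))
            * ((2⁻¹ : ℝ) ^ m * Real.exp (a * M / (4 * k))) ≤ 2 ^ m * Real.exp (-(a * M / (4 * k)))
          * ((2⁻¹ : ℝ) ^ pathChanges f M q.1 q.2 * r ^ pathVisits G M q.1 q.2) := by gcongr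
        linarith
    · positivity
  have hsum := Finset.sum_le_sum fun q (_ : q ∈ Finset.univ) => hpt q
  rw [Finset.sum_boole, Finset.sum_add_distrib, ← Finset.mul_sum, ← Finset.mul_sum,
    Fintype.sum_prod_type, Fintype.sum_prod_type] at hsum
  refine hsum.trans (add_le_add (le_of_eq ?_) ?_)
  · have h := congrArg (Nat.cast : ℕ → ℝ) (sum_pathVisits Gᶜ M)
    push_cast at h
    dsimp only
    rw [h]
    field_simp
  · gcongr
    calc _ ≤ ∑ _x : Cube k, (k : ℝ) ^ M := Finset.sum_le_sum fun x _ => sum_path_weight_le f a M x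
      _ = _ := by simp

/-! ### From discrete paths to the continuous-time walk -/

lemma jumpChain_succ_of_mem_ringsFirst {k : ℕ} {w : WalkSpace k} {j : ℕ} {i : Fin k}
    (h : w.2 j ∈ ringsFirst i) : jumpChain w (j + 1) = (jumpChain w j).flip i := by
  have h' : ∀ a, a ≠ i → w.2 j i < w.2 j a := h
  funext a
  simp only [jumpChain, Cube.flip]
  by_cases ha : a = i
  · subst ha
    rw [if_pos, Function.update_self]
    intro b
    by_cases hb : b = a
    · rw [hb]
    · exact (h' b hb).le
  · rw [if_neg, Function.update_of_ne ha]
    intro H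
    exact absurd (H i) (not_le.2 (h' a ha))

lemma pathChanges_jumpChain {k : ℕ} (f : Cube k → ℤˣ) {w : WalkSpace k} (M : ℕ) (j : ℕ)
    (s : Fin M → Fin k) (h : ∀ l : Fin M, w.2 (j + l) ∈ ringsFirst (s l)) :
    pathChanges f M (jumpChain w j) s = ∑ l ∈ Finset.range M,
      if f (jumpChain w (j + l)) ≠ f (jumpChain w (j + l + 1)) then 1 else 0 := by
  induction M generalizing j with
  | zero => simp [pathChanges]
  | succ M ih =>
    have h0 : jumpChain w (j + 1) = (jumpChain w j).flip (s 0) :=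
      jumpChain_succ_of_mem_ringsFirst (by simpa using h 0)
    have h1 := ih (j + 1) (Fin.tail s) fun l => by
      have := h l.succ
      rwa [Fin.val_succ, add_comm (l : ℕ) 1, ← add_assoc] at this
    rw [Finset.sum_range_succ', pathChanges, ← h0, h1, add_comm]
    simp only [add_zero]
    congr 1
    refine Finset.sum_congr rfl fun l _ => ?_
    rw [add_right_comm j 1 l, add_assoc j l 1]

lemma walk_eq_jumpChain {k : ℕ} {w : WalkSpace k} {t : ℝ} {j : ℕ}
    (h : ∀ l, jumpTime w l ≤ ENNReal.ofReal t ↔ l < j) : walk w t = jumpChain w j := by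
  have : {l : ℕ | jumpTime w l ≤ ENNReal.ofReal t} = ↑(Finset.range j) := by
    ext l; simp [h l]
  rw [walk, this, Set.ncard_coe_finset, Finset.card_range]

lemma jumpTime_ne_top {k : ℕ} (hk : 0 < k) (w : WalkSpace k) (j : ℕ) : jumpTime w j ≠ ⊤ :=
  ENNReal.sum_ne_top.2 fun _ _ =>
    ne_top_of_le_ne_top ENNReal.ofReal_ne_top (iInf_le _ ⟨0, hk⟩)

lemma holding_pos {k : ℕ} (hk : 0 < k) {w : WalkSpace k} (hpos : ∀ l i, 0 < w.2 l i) (j : ℕ) :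
    0 < ⨅ i, ENNReal.ofReal (w.2 j i) := by
  have : Nonempty (Fin k) := ⟨⟨0, hk⟩⟩
  obtain ⟨i, hi⟩ := exists_eq_ciInf_of_finite (f := fun i => ENNReal.ofReal (w.2 j i))
  rw [← hi]
  simpa using hpos j i

lemma strictMono_jumpTime {k : ℕ} (hk : 0 < k) {w : WalkSpace k} (hpos : ∀ l i, 0 < w.2 l i) :
    StrictMono (jumpTime w) := by
  refine strictMono_nat_of_lt_succ fun j => ?_
  have h := ENNReal.lt_add_right (jumpTime_ne_top hk w j) (holding_pos hk hpos (j + 1)).ne'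
  rwa [jumpTime, ← Finset.sum_range_succ _ (j + 1)] at h

lemma toReal_jumpTime_pos {k : ℕ} (hk : 0 < k) {w : WalkSpace k} (hpos : ∀ l i, 0 < w.2 l i)
    (j : ℕ) : 0 < (jumpTime w j).toReal := by
  refine ENNReal.toReal_pos (fun h0 => ?_) (jumpTime_ne_top hk w j)
  exact (holding_pos hk hpos j).ne' (Finset.sum_eq_zero_iff.1 h0 j (by simp))

lemma not_eventually_eq_at_jumpTime {k : ℕ} (hk : 0 < k) (f : Cube k → ℤˣ) {w : WalkSpace k}
    (hpos : ∀ l i, 0 < w.2 l i) {j : ℕ} (hj : f (jumpChain w j) ≠ f (jumpChain w (j + 1))) :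
    ¬ ∀ᶠ s in 𝓝[<] (jumpTime w j).toReal, f (walk w s) = f (walk w (jumpTime w j).toReal) := by
  have hT := strictMono_jumpTime hk hpos
  have hfin := jumpTime_ne_top hk w
  -- Jumps at time exactly `t` are counted in `walk w t`, so at this time `j + 1` jumps have been
  -- made, and just before it only `j`.
  have hat : walk w (jumpTime w j).toReal = jumpChain w (j + 1) :=
    walk_eq_jumpChain fun l => by
      rw [ENNReal.ofReal_toReal (hfin j), hT.le_iff_le, Nat.lt_succ_iff]
  have hbefore : ∀ᶠ s in 𝓝[<] (jumpTime w j).toReal, walk w s = jumpChain w j := by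
    have h1 : ∀ᶠ s in 𝓝[<] (jumpTime w j).toReal,
        ∀ l ∈ Finset.range j, (jumpTime w l).toReal < s := by
      rw [Filter.eventually_all_finset]
      intro l hl
      refine mem_nhdsWithin_of_mem_nhds (Ioi_mem_nhds ?_)
      exact (ENNReal.toReal_lt_toReal (hfin l) (hfin j)).2 (hT (Finset.mem_range.1 hl))
    filter_upwards [h1, self_mem_nhdsWithin] with s hs1 hs2
    refine walk_eq_jumpChain fun l => ⟨fun hl => ?_, fun hl => ?_⟩
    · refine hT.lt_iff_lt.1 (lt_of_le_of_lt hl ?_)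
      rw [← ENNReal.ofReal_toReal (hfin j)]
      exact (ENNReal.ofReal_lt_ofReal_iff (toReal_jumpTime_pos hk hpos j)).2 hs2
    · rw [← ENNReal.ofReal_toReal (hfin l)]
      exact ENNReal.ofReal_le_ofReal (hs1 l (Finset.mem_range.2 hl)).le
  intro h
  obtain ⟨s, hs, hs'⟩ := (h.and hbefore).exists
  rw [hs', hat] at hs
  exact hj hs

/-- Positive holding times make the jump times distinct, so different changes of the chain occur at
different times in `(0, 1]`. -/
lemma sum_jumpChain_changes_le_changeCount {k : ℕ} (hk : 0 < k) (f : Cube k → ℤˣ)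
    {w : WalkSpace k} (hpos : ∀ l i, 0 < w.2 l i) {M : ℕ}
    (hM : ∑ l ∈ Finset.range M, ⨅ i, ENNReal.ofReal (w.2 l i) ≤ 1) :
    ((∑ l ∈ Finset.range M,
      if f (jumpChain w l) ≠ f (jumpChain w (l + 1)) then 1 else 0 : ℕ) : ℕ∞)
        ≤ changeCount f w := by
  have hT := strictMono_jumpTime hk hpos
  have hfin := jumpTime_ne_top hk w
  set A := (Finset.range M).filter fun l => f (jumpChain w l) ≠ f (jumpChain w (l + 1)) with hA
  have hinj : Function.Injective fun l => (jumpTime w l).toReal := fun a b h =>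
    hT.injective ((ENNReal.toReal_eq_toReal_iff' (hfin a) (hfin b)).1 h)
  rw [Finset.sum_boole, Nat.cast_id, ← hA, ← Finset.card_image_of_injective A hinj,
    ← Set.encard_coe_eq_coe_finsetCard]
  refine Set.encard_le_encard fun t ht => ?_
  obtain ⟨l, hl, rfl⟩ := Finset.mem_image.1 (Finset.mem_coe.1 ht)
  obtain ⟨hlM, hlf⟩ := Finset.mem_filter.1 hl
  refine ⟨⟨toReal_jumpTime_pos hk hpos l, ?_⟩, not_eventually_eq_at_jumpTime hk f hpos hlf⟩
  · refine ENNReal.toReal_le_of_le_ofReal zero_le_one ?_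
    rw [ENNReal.ofReal_one]
    refine le_trans (Finset.sum_le_sum_of_subset ?_) hM
    exact Finset.range_mono (Finset.mem_range.1 hlM)

/-! ### The quantitative bound and the limit -/

lemma walkMeasure_changeCount_le {k : ℕ} (hk : 0 < k) (f : Cube k → ℤˣ) (a m : ℕ) {M : ℕ}
    (hM : 0 < M) :
    walkMeasure k {w | changeCount f w ≤ m} ≤ M * (k : ℝ≥0∞)⁻¹
      + ENNReal.ofReal (2 * ((manyPivotals f a)ᶜ.card / Fintype.card (Cube k))
        + 2 ^ m * Real.exp (-(a * M / (4 * k)))) := by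
  have hk' : (0 : ℝ) < k := by exact_mod_cast hk
  have hN : (0 : ℝ) < Fintype.card (Cube k) := by exact_mod_cast Fintype.card_pos
  set A := Finset.univ.filter fun q : Cube k × (Fin M → Fin k) => pathChanges f M q.1 q.2 ≤ m
  -- Almost surely clocks are positive and without ties. Then either the `M` jumps take too long, or
  -- the path followed is one of those counted in `A`.
  have hsub : ∀ᵐ w ∂walkMeasure k, w ∈ {w | changeCount f w ≤ m} →
      w ∈ {w | 1 < ∑ l ∈ Finset.range M, ⨅ i, ENNReal.ofReal (w.2 l i)} ∪
        ⋃ q ∈ A, {w : WalkSpace k | w.1 = q.1 ∧ ∀ l : Fin M, w.2 l ∈ ringsFirst (q.2 l)} := by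
    filter_upwards [walkMeasure_ae_snd (clocksMeasure_ae_forall (clockMeasure_ae_pos k)),
      walkMeasure_ae_snd (clocksMeasure_ae_forall (clockMeasure_ae_injective k))]
      with w hpos hinj hw
    by_cases hT : ∑ l ∈ Finset.range M, ⨅ i, ENNReal.ofReal (w.2 l i) ≤ 1
    · right
      choose s hs using fun l : Fin M => exists_mem_ringsFirst hk (hinj l)
      refine Set.mem_iUnion₂.2 ⟨(w.1, s), ?_, rfl, hs⟩
      have h1 := pathChanges_jumpChain f (w := w) M 0 s (by simpa using hs)
      have h2 := sum_jumpChain_changes_le_changeCount hk f hpos hT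
      simp only [zero_add] at h1
      rw [← h1] at h2
      exact Finset.mem_filter.2 ⟨Finset.mem_univ _, by exact_mod_cast h2.trans hw⟩
    · left
      exact not_le.1 hT
  refine (measure_mono_ae hsub).trans ((measure_union_le _ _).trans
    (add_le_add (walkMeasure_sum_holding_gt_one_le hk M) ?_))
  calc _ ≤ ∑ q ∈ A, walkMeasure k {w | w.1 = q.1 ∧ ∀ l : Fin M, w.2 l ∈ ringsFirst (q.2 l)} :=
        measure_biUnion_finset_le _ _
    _ ≤ ∑ _q ∈ A, (Fintype.card (Cube k) : ℝ≥0∞)⁻¹ * ((k : ℝ≥0∞)⁻¹) ^ M :=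
        Finset.sum_le_sum fun q _ => walkMeasure_directions_le M q.1 q.2
    _ = ENNReal.ofReal (A.card * ((Fintype.card (Cube k) : ℝ)⁻¹ * ((k : ℝ)⁻¹) ^ M)) := by
        rw [Finset.sum_const, nsmul_eq_mul, ENNReal.ofReal_mul (by positivity),
          ENNReal.ofReal_mul (by positivity), ENNReal.ofReal_pow (by positivity),
          ENNReal.ofReal_inv_of_pos hN, ENNReal.ofReal_inv_of_pos hk']
        simp only [ENNReal.ofReal_natCast]
    _ ≤ _ := by
        refine ENNReal.ofReal_le_ofReal ?_
        calc _ ≤ (2 * (manyPivotals f a)ᶜ.card * (k : ℝ) ^ M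
              + 2 ^ m * Real.exp (-(a * M / (4 * k))) * (Fintype.card (Cube k) * (k : ℝ) ^ M))
              * ((Fintype.card (Cube k) : ℝ)⁻¹ * ((k : ℝ)⁻¹) ^ M) := by
              gcongr
              exact card_pathChanges_le f a m hM
          _ = _ := by
              rw [inv_pow]
              field_simp

lemma uniformCube_manyPivotals {k : ℕ} (f : Cube k → ℤˣ) (a : ℕ) :
    ((manyPivotals f a)ᶜ.card : ℝ) / Fintype.card (Cube k)
      = 1 - (uniformCube k {ω | a < (pivotalSet f ω).card}).toReal := by
  have hN : (0 : ℝ) < Fintype.card (Cube k) := by exact_mod_cast Fintype.card_pos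
  have h : {ω | a < (pivotalSet f ω).card} = (manyPivotals f a : Set (Cube k)) := by
    ext; simp [manyPivotals]
  have h2 : uniformCube k (manyPivotals f a : Set (Cube k))
      = (manyPivotals f a).card / Fintype.card (Cube k) := by
    rw [uniformCube, PMF.toMeasure_uniformOfFintype_apply _ (Finset.measurableSet _)]
    simp
  rw [h, h2, ENNReal.toReal_div, Finset.card_compl, Nat.cast_sub (Finset.card_le_univ _)]
  simp only [ENNReal.toReal_natCast]
  field_simp

lemma volatile_of_tendsto_pivotals (k : ℕ → ℕ) (f : ∀ n, Cube (k n) → ℤˣ) (a : ℕ → ℕ)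
    (ha : Tendsto a atTop atTop)
    (hpiv : Tendsto (fun n => uniformCube (k n) {ω | a n < (pivotalSet (f n) ω).card})
      atTop (𝓝 1)) : Volatile k f := by
  intro m
  rw [ENNReal.tendsto_nhds_zero]
  intro ε hε
  obtain ⟨q, hq⟩ := ENNReal.exists_inv_nat_lt (ENNReal.half_pos hε.ne').ne'
  have hq0 : 0 < q := by
    rcases Nat.eq_zero_or_pos q with rfl | h
    · simp at hq
    · exact h
  have hq0' : (0 : ℝ) < q := by exact_mod_cast hq0
  -- An event of positive probability is nonempty, and a pivotal set has at most `k n` elements.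
  have hka : ∀ᶠ n in atTop, a n ≤ k n := by
    filter_upwards [hpiv.eventually (lt_mem_nhds zero_lt_one)] with n hn
    obtain ⟨ω, hω⟩ := nonempty_of_measure_ne_zero hn.ne'
    have h1 := Finset.card_le_univ (pivotalSet (f n) ω)
    rw [Fintype.card_fin] at h1
    exact (le_of_lt hω).trans h1
  have hsmall : Tendsto (fun n => ENNReal.ofReal
      (2 * (1 - (uniformCube (k n) {ω | a n < (pivotalSet (f n) ω).card}).toReal)
        + 2 ^ m * Real.exp (-(a n / (8 * q))))) atTop (𝓝 0) := by
    have h1 := (ENNReal.tendsto_toReal ENNReal.one_ne_top).comp hpiv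
    have h2 : Tendsto (fun n => (a n : ℝ) / (8 * q)) atTop atTop :=
      (tendsto_natCast_atTop_atTop.comp ha).atTop_div_const (by positivity)
    have h3 := Real.tendsto_exp_neg_atTop_nhds_zero.comp h2
    have h4 := ((h1.const_sub 1).const_mul 2).add (h3.const_mul (2 ^ m))
    have h5 := ENNReal.tendsto_ofReal h4
    simpa [Function.comp_def] using h5
  filter_upwards [hka, ha.eventually_ge_atTop q,
    (ENNReal.tendsto_nhds_zero.1 hsmall) _ (ENNReal.half_pos hε.ne')] with n hn1 hn2 hn3
  have hqk : q ≤ k n := hn2.trans hn1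
  have hk : 0 < k n := hq0.trans_le hqk
  have hk' : (0 : ℝ) < k n := by exact_mod_cast hk
  have hM : 0 < k n / q := Nat.div_pos hqk hq0
  refine (walkMeasure_changeCount_le hk (f n) (a n) m hM).trans ?_
  rw [← ENNReal.add_halves ε]
  refine add_le_add (le_trans ?_ hq.le) (le_trans (ENNReal.ofReal_le_ofReal ?_) hn3)
  · rw [ENNReal.le_inv_iff_mul_le, mul_right_comm, ← Nat.cast_mul, ← div_eq_mul_inv]
    refine ENNReal.div_le_of_le_mul ?_
    rw [one_mul]
    exact_mod_cast Nat.div_mul_le_self _ _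
  · rw [uniformCube_manyPivotals]
    -- Rounding down loses at most a factor `2` because `q ≤ k n`; this turns `4` into the `8` of
    -- `hsmall`.
    have h1 : k n ≤ 2 * q * (k n / q) := by
      have := Nat.lt_mul_div_succ (k n) hq0
      nlinarith
    have h1' : (k n : ℝ) ≤ 2 * q * (k n / q : ℕ) := by exact_mod_cast h1
    have h2 : (a n : ℝ) / (8 * q) ≤ a n * (k n / q : ℕ) / (4 * k n) := by
      rw [div_le_div_iff₀ (by positivity) (by positivity)]
      calc (a n : ℝ) * (4 * k n) ≤ a n * (4 * (2 * q * (k n / q : ℕ))) := by gcongr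
        _ = _ := by ring
    have h3 := Real.exp_le_exp.2 (neg_le_neg h2)
    gcongr

theorem mainTheorem4 (k : ℕ → ℕ) (f : ∀ n, Cube (k n) → ℤˣ) (a : ℕ → ℕ)
    (ha : Tendsto a atTop atTop)
    (hpiv : Tendsto (fun n => uniformCube (k n) {ω | a n < (pivotalSet (f n) ω).card})
      atTop (𝓝 1)) :
    Volatile k f ∧
      Tendsto (fun n => walkMeasure (k n) {w | changeCount (f n) w = 0}) atTop (𝓝 0) := by
  have h := volatile_of_tendsto_pivotals k f a ha hpiv
  exact ⟨h, by simpa using h 0⟩
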